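/- Let $m=(m_0,m_1,\dots)$ be a sequence of integers $m_k\ge 2$, put $M_0:=1$, $M_{k+1}:=m_kM_k$, and let $G_m:=\prod_{k\ge 0}\mathbb Z_{m_k}$ be the corresponding Vilenkin group with its normalized Haar measure $\mu$ (the product of the uniform measures). Every $n\in\mathbb N$ has a unique expansion $n=\sum_j n_jM_j$ with $0\le n_j<m_j$; let $r_k(x):=\exp(2\pi i x_k/m_k)$ and $\psi_n:=\prod_k r_k^{n_k}$ be the Vilenkin system. Let $\mathcal F_n$ be the $\sigma$-algebra generated by the sets $I_n(x):=\{y: y_0=x_0,\dots,y_{n-1}=x_{n-1}\}$, $x\in G_m$. The space $H_1(G_m)$ consists of the martingales $f=(f_n)_{n\in\mathbb N}$ with respect to $(\mathcal F_n)$ for which $\|f\|_{H_1}:=\big\|\sup_n|f_n|\big\|_1<\infty$; such an $f$ is identified with its almost everywhere limit, an integrable function (also denoted by $f$) with $f_n=E[f\mid\mathcal F_n]$ for all $n$. An integrable function $g$ is identified with the martingale $(S_{M_k}g)_k$. For a martingale $f$ put $\widehat f(i):=\lim_{k\to\infty}\int_{G_m}f_k\overline{\psi_i}\,d\mu$, $S_nf:=\sum_{i=0}^{n-1}\widehat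 f(i)\psi_i$, and let $$\omega(1/M_n,f)_{H_1}:=\|f-S_{M_n}f\|_{H_1}.$$ (a) Suppose that the sequence $m$ is bounded. If $f\in H_1(G_m)$ and $\omega(1/M_n,f)_{H_1}=o(1/n)$ as $n\to\infty$, then $\|S_kf-f\|_1\to 0$ as $k\to\infty$. (b) For every $m$ (bounded or not) there exists a martingale $f\in H_1(G_m)$ for which $\omega(1/M_{2M_n},f)_{H_1}=O(1/M_n)$ as $n\to\infty$, but $\|S_kf-f\|_1\not\to 0$ as $k\to\infty$. -/

import Mathlib

open MeasureTheory Filter Topology Asymptotics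
open scoped ENNReal

namespace Vilenkin

/-- The Vilenkin group `G_m`: the complete direct product of the cyclic groups `Z_{m_k}`. -/
abbrev G (m : ℕ → ℕ) : Type := ∀ k, ZMod (m k)

/-- The direct product of the uniform measures `μ_k({j}) = 1 / m_k`
(the normalized Haar measure of `G_m`). -/
noncomputable def μ (m : ℕ → ℕ) : Measure (G m) :=
  Measure.infinitePi fun k => ProbabilityTheory.uniformOn (Set.univ : Set (ZMod (m k)))

/-- The generalized powers: `M_0 = 1`, `M_{k+1} = m_k M_k`. -/
def M (m : ℕ → ℕ) : ℕ → ℕ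
  | 0 => 1
  | k + 1 => m k * M m k

/-- The digit `n_j` in the expansion `n = ∑ n_j M_j`, `n_j ∈ {0, …, m_j - 1}`. -/
def digit (m : ℕ → ℕ) (n j : ℕ) : ℕ := n / M m j % m j

/-- The generalized Rademacher function `r_k(x) = exp(2πi x_k / m_k)`. -/
noncomputable def rademacher (m : ℕ → ℕ) (k : ℕ) (x : G m) : ℂ :=
  Complex.exp (2 * Real.pi * Complex.I * ((x k).val : ℂ) / (m k : ℂ))

/-- The Vilenkin function `ψ_n = ∏_k r_k ^ n_k`. The factors with `k ≥ n` are omitted: there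
`n < 2 ^ k ≤ M_k`, so that `n_k = 0` (all `m_j` being at least `2`). -/
noncomputable def psi (m : ℕ → ℕ) (n : ℕ) (x : G m) : ℂ :=
  ∏ k ∈ Finset.range n, rademacher m k x ^ digit m n k

/-- The interval `I_n(x)` of all `y` whose first `n` coordinates agree with those of `x`. -/
def interval (m : ℕ → ℕ) (n : ℕ) (x : G m) : Set (G m) := {y | ∀ i < n, y i = x i}

/-- The σ-algebra generated by the intervals `I_n(x)`, `x ∈ G_m`. -/
abbrev sigma (m : ℕ → ℕ) (n : ℕ) : MeasurableSpace (G m) :=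
  MeasurableSpace.generateFrom (Set.range (interval m n))

theorem sigma_le (m : ℕ → ℕ) (n : ℕ) : sigma m n ≤ MeasurableSpace.pi := by
  refine MeasurableSpace.generateFrom_le ?_
  rintro _ ⟨x, rfl⟩
  have h : interval m n x = ⋂ i ∈ Set.Iio n, (fun y : G m => y i) ⁻¹' {x i} := by
    ext y; simp [interval]
  rw [h]
  exact MeasurableSet.biInter (Set.to_countable _) fun i _ =>
    measurable_pi_apply i (MeasurableSpace.measurableSet_top (s := {x i}))

theorem sigma_mono (m : ℕ → ℕ) : Monotone (sigma m) := by
  intro n n' hn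
  refine MeasurableSpace.generateFrom_le ?_
  rintro _ ⟨x, rfl⟩
  have h : interval m n x = ⋃₀ (interval m n' '' interval m n x) := by
    ext y
    simp only [Set.mem_sUnion, Set.mem_image]
    constructor
    · intro hy
      exact ⟨_, ⟨y, hy, rfl⟩, fun i _ => rfl⟩
    · rintro ⟨_, ⟨z, hz, rfl⟩, hy⟩ i hi
      exact (hy i (hi.trans_le hn)).trans (hz i hi)
  have hc : (Set.range (interval m n')).Countable := by
    have hsub : Set.range (interval m n') ⊆ Set.range
        (fun z : (∀ i : Fin n', ZMod (m i)) => {y : G m | ∀ i : Fin n', y i = z i}) := by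
      rintro _ ⟨x, rfl⟩
      refine ⟨fun i => x i, ?_⟩
      ext y
      exact ⟨fun hy i hi => hy ⟨i, hi⟩, fun hy i => hy i i.2⟩
    have hz : ∀ k, Countable (ZMod k) := fun k => by
      cases k
      · exact inferInstanceAs (Countable ℤ)
      · exact inferInstanceAs (Countable (Fin _))
    exact Set.Countable.mono hsub (Set.countable_range _)
  rw [h]
  refine MeasurableSet.sUnion (hc.mono (Set.image_subset_range _ _)) ?_
  rintro _ ⟨z, _, rfl⟩
  exact MeasurableSpace.measurableSet_generateFrom ⟨z, rfl⟩

/-- The filtration of the σ-algebras generated by the intervals of rank `n`. -/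
def filtration (m : ℕ → ℕ) : Filtration ℕ (MeasurableSpace.pi : MeasurableSpace (G m)) where
  seq := sigma m
  mono' := sigma_mono m
  le' := sigma_le m

/-- The `i`-th Vilenkin–Fourier coefficient of an integrable function. -/
noncomputable def coeffFun (m : ℕ → ℕ) (g : G m → ℂ) (i : ℕ) : ℂ :=
  ∫ x, g x * (starRingEnd ℂ) (psi m i x) ∂μ m

/-- The `i`-th Vilenkin–Fourier coefficient of a martingale, `lim_k ∫ f_k conj(ψ_i) dμ`
(the sequence is eventually constant). -/
noncomputable def coeff (m : ℕ → ℕ) (f : ℕ → G m → ℂ) (i : ℕ) : ℂ :=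
  limUnder atTop fun k => coeffFun m (f k) i

/-- The partial sum `S_n g = ∑_{k < n} ĝ(k) ψ_k` of an integrable function. -/
noncomputable def partialSumFun (m : ℕ → ℕ) (n : ℕ) (g : G m → ℂ) (x : G m) : ℂ :=
  ∑ k ∈ Finset.range n, coeffFun m g k * psi m k x

/-- The partial sum `S_n f = ∑_{k < n} f̂(k) ψ_k` of a martingale. -/
noncomputable def partialSum (m : ℕ → ℕ) (n : ℕ) (f : ℕ → G m → ℂ) (x : G m) : ℂ :=
  ∑ k ∈ Finset.range n, coeff m f k * psi m k x

/-- The martingale `(S_{M_k} g)_k` obtained from an integrable function `g`. -/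
noncomputable def toMartingale (m : ℕ → ℕ) (g : G m → ℂ) (k : ℕ) : G m → ℂ :=
  partialSumFun m (M m k) g

/-- The maximal function `f^* = sup_n |f_n|`, with values in `[0, ∞]`. -/
noncomputable def maximal (m : ℕ → ℕ) (f : ℕ → G m → ℂ) (x : G m) : ℝ≥0∞ := ⨆ n, ‖f n x‖ₑ

/-- The Hardy norm `‖f‖_{H_1} = ‖f^*‖_1`, with values in `[0, ∞]`. -/
noncomputable def hardyNorm (m : ℕ → ℕ) (f : ℕ → G m → ℂ) : ℝ≥0∞ := ∫⁻ x, maximal m f x ∂μ m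

/-- Membership in the martingale Hardy space `H_1(G_m)`. -/
def MemHardy (m : ℕ → ℕ) (f : ℕ → G m → ℂ) : Prop :=
  Martingale f (filtration m) (μ m) ∧ hardyNorm m f < ∞

/-- The modulus of continuity `ω(1 / M_n, f)_{H_1} = ‖f - S_{M_n} f‖_{H_1}`, the function
`S_{M_n} f` being regarded as a martingale. -/
noncomputable def modulus (m : ℕ → ℕ) (n : ℕ) (f : ℕ → G m → ℂ) : ℝ≥0∞ :=
  hardyNorm m fun k x => f k x - toMartingale m (partialSum m (M m n) f) k x

/-- The pointwise limit `lim_n f_n(x)` of a martingale (used where it exists almost everywhere). -/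
noncomputable def limit (m : ℕ → ℕ) (f : ℕ → G m → ℂ) (x : G m) : ℂ :=
  limUnder atTop fun n => f n x

/-- `F` is the function of `L_1(G_m)` with which the martingale `f` is identified:
`F` is integrable, `f_n → F` almost everywhere, and `f_n` is the conditional expectation of `F`. -/
def Represents (m : ℕ → ℕ) (F : G m → ℂ) (f : ℕ → G m → ℂ) : Prop :=
  MemLp F 1 (μ m) ∧ (∀ᵐ x ∂μ m, Tendsto (fun n => f n x) atTop (𝓝 (F x))) ∧
    ∀ n, (μ m)[F | filtration m n] =ᵐ[μ m] f n

end Vilenkin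

/-! Everything rests on the kernel identity `sum_psi_M`: D_{M_n} is M_n times the indicator of
I_n(0). Hence S_{M_n} averages over intervals of rank n, is the conditional expectation on F_n, and
contracts L_1. A martingale f in H_1 has an a.e. limit F with f_n = S_{M_n}F, and the modulus is the
H_1 norm of f minus f stopped at n; it dominates ‖F - f_n‖_1.

(a) Let M_N ≤ k < M_{N+1}. Since S_k fixes f_N, the error S_kF - F equals (S_k - 1)(F - f_N).
Cutting S_k along the digits of k into modulated copies of the contractions S_{M_j} shows that its
L_1 norm is at most B(N+1) (`eLpNorm_partialSumFun_le`). The error is therefore O(N) times a modulus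
that is o(1/N).

(b) Take f = ∑_k M_k^{-1} (D_{M_{j+1}} - D_{M_j}) with j = 2M_k. The kernel differences have L_1
norm at most 2 and M_k at least doubles with k, so the tails have H_1 norm O(1/M_n). Inside the k-th
block, summing q further terms past M_j adds M_k^{-1} ψ_{M_j} D_q. With q = `alternatingIndex m (M m
k)`, which fits in the block, ‖D_q‖_1 ≥ M_k/4 (`le_lintegral_enorm_sum_psi`). The increments thus
keep norm at least 1/4, and the partial sums are not Cauchy in L_1. -/

namespace Vilenkin

/-! ### Mixed-radix digits, characters and the kernels D_{M_n} -/

section Digits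

variable {m : ℕ → ℕ}

theorem M_succ (m : ℕ → ℕ) (k : ℕ) : M m (k + 1) = m k * M m k := rfl

theorem M_pos (hm : ∀ k, 2 ≤ m k) (k : ℕ) : 0 < M m k := by
  induction k with
  | zero => exact Nat.one_pos
  | succ k ih => exact Nat.mul_pos (by have := hm k; omega) ih

theorem two_mul_M_le (hm : ∀ k, 2 ≤ m k) (k : ℕ) : 2 * M m k ≤ M m (k + 1) :=
  Nat.mul_le_mul_right _ (hm k)

theorem pred_mul_M_add_M (hm : ∀ k, 2 ≤ m k) (k : ℕ) :
    (m k - 1) * M m k + M m k = M m (k + 1) := by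
  have := hm k
  rw [M_succ, ← Nat.succ_mul, Nat.succ_eq_add_one, Nat.sub_add_cancel (by omega)]

theorem M_strictMono (hm : ∀ k, 2 ≤ m k) : StrictMono (M m) :=
  strictMono_nat_of_lt_succ fun k => by
    have := two_mul_M_le hm k
    have := M_pos hm k
    omega

theorem lt_M (hm : ∀ k, 2 ≤ m k) (k : ℕ) : k < M m k := by
  induction k with
  | zero => exact Nat.one_pos
  | succ k ih => have := two_mul_M_le hm k; omega

theorem M_dvd (m : ℕ → ℕ) {j k : ℕ} (h : j ≤ k) : M m j ∣ M m k := by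
  induction k, h using Nat.le_induction with
  | base => exact dvd_rfl
  | succ k _ ih => exact ih.mul_left _

theorem digit_eq_zero {n j : ℕ} (h : n < M m j) : digit m n j = 0 := by
  simp [digit, Nat.div_eq_of_lt h]

theorem digit_add_low (hm : ∀ k, 2 ≤ m k) {j l : ℕ} (h : l < j) (c i : ℕ) :
    digit m (c * M m j + i) l = digit m i l := by
  obtain ⟨q, hq⟩ := M_dvd m (Nat.succ_le_of_lt h)
  have h1 : c * M m j + i = i + M m l * (m l * (c * q)) := by
    rw [hq, M_succ]; ring
  rw [digit, digit, h1, Nat.add_mul_div_left _ _ (M_pos hm l), Nat.add_mul_mod_self_left]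

theorem digit_add_high (hm : ∀ k, 2 ≤ m k) {j l : ℕ} (h : j ≤ l) (c : ℕ) {i : ℕ}
    (hi : i < M m j) : digit m (c * M m j + i) l = digit m (c * M m j) l := by
  obtain ⟨q, hq⟩ := M_dvd m h
  have h1 : (c * M m j + i) / M m j = c := by
    rw [add_comm, Nat.add_mul_div_right _ _ (M_pos hm j), Nat.div_eq_of_lt hi, zero_add]
  have h2 : c * M m j / M m j = c := Nat.mul_div_cancel _ (M_pos hm j)
  rw [digit, digit, hq, ← Nat.div_div_eq_div_mul, ← Nat.div_div_eq_div_mul, h1, h2]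

theorem psi_eq_prod (hm : ∀ k, 2 ≤ m k) {n K : ℕ} (h : n < M m K) (x : G m) :
    psi m n x = ∏ k ∈ Finset.range K, rademacher m k x ^ digit m n k := by
  -- Both products are compared with the one over `range (max n K)`; extra factors have digit zero.
  -- The second disjunct only sets aside ranges longer than that.
  have key : ∀ L, n < M m L → ∏ k ∈ Finset.range L, rademacher m k x ^ digit m n k =
      ∏ k ∈ Finset.range (max n K), rademacher m k x ^ digit m n k ∨ max n K < L := by
    intro L hL
    by_cases hlt : max n K < L
    · exact Or.inr hlt
    · left
      refine Finset.prod_subset (Finset.range_subset_range.2 (not_lt.1 hlt)) fun k _ hk => ?_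
      have hk' : L ≤ k := by simpa using hk
      rw [digit_eq_zero (hL.trans_le ((M_strictMono hm).monotone hk')), pow_zero]
  rw [psi, (key n (lt_M hm n)).resolve_right (by simp), (key K h).resolve_right (by simp)]

/-- No carries occur: the digits of c M_j sit at positions ≥ j, those of i at positions < j. -/
theorem psi_add (hm : ∀ k, 2 ≤ m k) (c j : ℕ) {i : ℕ} (hi : i < M m j) (x : G m) :
    psi m (c * M m j + i) x = psi m (c * M m j) x * psi m i x := by
  have hK := lt_M hm (c * M m j + i)
  rw [psi_eq_prod hm hK, psi_eq_prod hm (n := c * M m j) (lt_of_le_of_lt (Nat.le_add_right _ _) hK),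
    psi_eq_prod hm (n := i) (lt_of_le_of_lt (Nat.le_add_left _ _) hK), ← Finset.prod_mul_distrib]
  refine Finset.prod_congr rfl fun l _ => ?_
  rw [← pow_add]
  congr 1
  rcases lt_or_ge l j with h | h
  · have h0 := digit_add_low hm h c 0
    rw [digit_add_low hm h, ← add_zero (c * M m j), h0]
    simp [digit]
  · rw [digit_add_high hm h c hi, digit_eq_zero (hi.trans_le ((M_strictMono hm).monotone h)),
      add_zero]

theorem psi_zero (m : ℕ → ℕ) (x : G m) : psi m 0 x = 1 := by simp [psi]

theorem psi_mul_M (hm : ∀ k, 2 ≤ m k) {a k : ℕ} (ha : a < m k) (x : G m) :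
    psi m (a * M m k) x = rademacher m k x ^ a := by
  have hlt : a * M m k < M m (k + 1) := Nat.mul_lt_mul_of_pos_right ha (M_pos hm k)
  rw [psi_eq_prod hm hlt, Finset.prod_range_succ, Finset.prod_eq_one, one_mul, digit,
    Nat.mul_div_cancel _ (M_pos hm k), Nat.mod_eq_of_lt ha]
  intro l hl
  have := digit_add_low hm (Finset.mem_range.1 hl) a 0
  rw [add_zero] at this
  rw [this]
  simp [digit]

theorem psi_congr (hm : ∀ k, 2 ≤ m k) {n N : ℕ} (hn : n < M m N) {x y : G m}
    (h : ∀ i < N, x i = y i) : psi m n x = psi m n y := by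
  rw [psi_eq_prod hm hn, psi_eq_prod hm hn]
  refine Finset.prod_congr rfl fun k hk => ?_
  rw [rademacher, rademacher, h k (Finset.mem_range.1 hk)]

theorem rademacher_eq (hm : ∀ k, 2 ≤ m k) (k : ℕ) (x : G m) :
    haveI : NeZero (m k) := ⟨by have := hm k; omega⟩
    rademacher m k x = (ZMod.toCircle (x k) : ℂ) := by
  have : NeZero (m k) := ⟨by have := hm k; omega⟩
  rw [ZMod.toCircle_apply, rademacher]

theorem norm_rademacher (hm : ∀ k, 2 ≤ m k) (k : ℕ) (x : G m) : ‖rademacher m k x‖ = 1 := by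
  rw [rademacher_eq hm]; exact Circle.norm_coe _

theorem rademacher_sub (hm : ∀ k, 2 ≤ m k) (k : ℕ) (x y : G m) :
    rademacher m k (x - y) = rademacher m k x * (starRingEnd ℂ) (rademacher m k y) := by
  have : NeZero (m k) := ⟨by have := hm k; omega⟩
  rw [rademacher_eq hm, rademacher_eq hm, rademacher_eq hm, Pi.sub_apply, AddChar.map_sub_eq_div,
    ← Circle.coe_inv_eq_conj, div_eq_mul_inv, Circle.coe_mul]

theorem norm_psi (hm : ∀ k, 2 ≤ m k) (n : ℕ) (x : G m) : ‖psi m n x‖ = 1 := by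
  rw [psi, norm_prod]
  exact Finset.prod_eq_one fun k _ => by rw [norm_pow, norm_rademacher hm, one_pow]

theorem psi_mul_conj (hm : ∀ k, 2 ≤ m k) (n : ℕ) (x : G m) :
    psi m n x * (starRingEnd ℂ) (psi m n x) = 1 := by
  rw [Complex.mul_conj, Complex.normSq_eq_norm_sq, norm_psi hm]; simp

theorem psi_sub (hm : ∀ k, 2 ≤ m k) (n : ℕ) (x y : G m) :
    psi m n (x - y) = psi m n x * (starRingEnd ℂ) (psi m n y) := by
  rw [psi, psi, psi, map_prod, ← Finset.prod_mul_distrib]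
  refine Finset.prod_congr rfl fun k _ => ?_
  rw [rademacher_sub hm, mul_pow, map_pow]

theorem sum_rademacher_pow (hm : ∀ k, 2 ≤ m k) (k : ℕ) (x : G m) :
    ∑ a ∈ Finset.range (m k), rademacher m k x ^ a = if x k = 0 then (m k : ℂ) else 0 := by
  have : NeZero (m k) := ⟨by have := hm k; omega⟩
  rw [rademacher_eq hm]
  split_ifs with h
  · simp [h]
  · have h1 : (ZMod.toCircle (x k) : ℂ) ≠ 1 := by
      intro h1
      apply h
      apply ZMod.injective_toCircle
      rw [AddChar.map_zero_eq_one]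
      exact Subtype.ext h1
    have h2 : (ZMod.toCircle (x k) : ℂ) ^ m k = 1 := by
      rw [← Circle.coe_pow, ← AddChar.map_nsmul_eq_pow]
      simp
    rw [geom_sum_eq h1, h2]; simp

/-- A sum over `[0, a M_k)` splits into `a` blocks of length `M_k`. -/
theorem sum_range_mul_M {E : Type*} [AddCommMonoid E] (u : ℕ → E) (a b : ℕ) :
    ∑ i ∈ Finset.range (a * b), u i =
      ∑ c ∈ Finset.range a, ∑ i ∈ Finset.range b, u (c * b + i) := by
  induction a with
  | zero => simp
  | succ a ih => rw [Nat.succ_mul, Finset.sum_range_add, ih, Finset.sum_range_succ]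

/-- The Dirichlet kernel of index `M_n` is `M_n` times the indicator of `I_n(0)`. -/
theorem sum_psi_M (hm : ∀ k, 2 ≤ m k) (n : ℕ) (x : G m) :
    ∑ i ∈ Finset.range (M m n), psi m i x =
      (interval m n 0).indicator (fun _ => (M m n : ℂ)) x := by
  induction n with
  | zero => simp [M, psi_zero, interval]
  | succ n ih =>
    classical
    rw [M_succ, sum_range_mul_M]
    have h1 : ∀ c ∈ Finset.range (m n), ∑ i ∈ Finset.range (M m n), psi m (c * M m n + i) x =
        rademacher m n x ^ c * ∑ i ∈ Finset.range (M m n), psi m i x := by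
      intro c hc
      rw [Finset.mul_sum]
      refine Finset.sum_congr rfl fun i hi => ?_
      rw [psi_add hm c n (Finset.mem_range.1 hi), psi_mul_M hm (Finset.mem_range.1 hc)]
    rw [Finset.sum_congr rfl h1, ← Finset.sum_mul, sum_rademacher_pow hm, ih]
    have h2 : x ∈ interval m (n + 1) 0 ↔ x ∈ interval m n 0 ∧ x n = 0 := by
      simp only [interval, Set.mem_ofPred_eq, Nat.forall_lt_succ_right, Pi.zero_apply]
    simp only [Set.indicator_apply, h2]
    by_cases h3 : x n = 0 <;> by_cases h4 : x ∈ interval m n 0 <;> simp [h3, h4]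

end Digits

/-! ### S_{M_n} as averaging operator and conditional expectation; orthonormality -/

section Projection

variable {m : ℕ → ℕ}

theorem isProbabilityMeasure_uniformOn_zmod (hm : ∀ k, 2 ≤ m k) (k : ℕ) :
    IsProbabilityMeasure (ProbabilityTheory.uniformOn (Set.univ : Set (ZMod (m k)))) := by
  have : NeZero (m k) := ⟨by have := hm k; omega⟩
  exact ProbabilityTheory.isProbabilityMeasure_uniformOn Set.finite_univ Set.univ_nonempty

theorem isProbabilityMeasure_μ (hm : ∀ k, 2 ≤ m k) : IsProbabilityMeasure (μ m) := by
  have := isProbabilityMeasure_uniformOn_zmod hm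
  unfold μ
  infer_instance

theorem measurableSet_interval (m : ℕ → ℕ) (n : ℕ) (x : G m) : MeasurableSet (interval m n x) :=
  sigma_le m n _ (MeasurableSpace.measurableSet_generateFrom ⟨x, rfl⟩)

theorem measure_interval (hm : ∀ k, 2 ≤ m k) (n : ℕ) (x : G m) :
    μ m (interval m n x) = (M m n : ℝ≥0∞)⁻¹ := by
  have := isProbabilityMeasure_uniformOn_zmod hm
  have h1 : interval m n x = Set.pi (Finset.range n : Finset ℕ) (fun i => {x i}) := by
    ext y; simp [interval, Set.mem_pi]
  rw [h1, μ, Measure.infinitePi_pi _ fun i _ => MeasurableSpace.measurableSet_top]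
  have h2 : ∀ i, ProbabilityTheory.uniformOn (Set.univ : Set (ZMod (m i))) {x i} =
      (m i : ℝ≥0∞)⁻¹ := by
    intro i
    have : NeZero (m i) := ⟨by have := hm i; omega⟩
    rw [ProbabilityTheory.uniformOn_univ,
      Measure.count_singleton' MeasurableSpace.measurableSet_top, ZMod.card, one_div]
  simp only [h2]
  induction n with
  | zero => simp [M]
  | succ n ih =>
    rw [Finset.prod_range_succ, ih, M_succ, Nat.cast_mul, mul_comm, ENNReal.mul_inv]
    · exact Or.inl (by have := hm n; simp; omega)
    · simp
    · ext y; simp [interval, Set.mem_pi]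

theorem measureReal_interval (hm : ∀ k, 2 ≤ m k) (n : ℕ) (x : G m) :
    (μ m).real (interval m n x) = (M m n : ℝ)⁻¹ := by
  rw [Measure.real, measure_interval hm]; simp

theorem measurable_psi (m : ℕ → ℕ) (n : ℕ) : Measurable (psi m n) := by
  refine Finset.measurable_prod _ fun k _ => Measurable.pow_const ?_ _
  exact (measurable_from_top (f := fun z : ZMod (m k) =>
    Complex.exp (2 * Real.pi * Complex.I * (z.val : ℂ) / (m k : ℂ)))).comp (measurable_pi_apply k)

theorem integrable_mul_conj_psi (hm : ∀ k, 2 ≤ m k) {g : G m → ℂ} (hg : Integrable g (μ m))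
    (n : ℕ) : Integrable (fun x => g x * (starRingEnd ℂ) (psi m n x)) (μ m) :=
  hg.mul_bdd (c := 1) (Complex.continuous_conj.measurable.comp
    (measurable_psi m n)).aestronglyMeasurable
    (ae_of_all _ fun x => by simp [norm_psi hm])

theorem integrable_psi (hm : ∀ k, 2 ≤ m k) (n : ℕ) : Integrable (psi m n) (μ m) := by
  have := isProbabilityMeasure_μ hm
  exact Integrable.of_bound (measurable_psi m n).aestronglyMeasurable 1
    (ae_of_all _ fun x => (norm_psi hm n x).le)

theorem integrable_partialSumFun (hm : ∀ k, 2 ≤ m k) (n : ℕ) (g : G m → ℂ) :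
    Integrable (partialSumFun m n g) (μ m) :=
  integrable_finsetSum _ fun i _ => (integrable_psi hm i).const_mul _

theorem coeffFun_sub (hm : ∀ k, 2 ≤ m k) {g h : G m → ℂ} (hg : Integrable g (μ m))
    (hh : Integrable h (μ m)) (i : ℕ) :
    coeffFun m (fun x => g x - h x) i = coeffFun m g i - coeffFun m h i := by
  simp only [coeffFun, sub_mul]
  exact integral_sub (integrable_mul_conj_psi hm hg i) (integrable_mul_conj_psi hm hh i)

theorem coeffFun_const_mul (c : ℂ) (g : G m → ℂ) (i : ℕ) :
    coeffFun m (fun x => c * g x) i = c * coeffFun m g i := by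
  simp only [coeffFun, mul_assoc]
  exact integral_const_mul _ _

theorem coeffFun_sum (hm : ∀ k, 2 ≤ m k) {s : Finset ℕ} {g : ℕ → G m → ℂ}
    (hg : ∀ j ∈ s, Integrable (g j) (μ m)) (i : ℕ) :
    coeffFun m (fun x => ∑ j ∈ s, g j x) i = ∑ j ∈ s, coeffFun m (g j) i := by
  simp only [coeffFun, Finset.sum_mul]
  exact integral_finsetSum _ fun j hj => integrable_mul_conj_psi hm (hg j hj) i

theorem coeffFun_congr_ae {g h : G m → ℂ} (hgh : g =ᵐ[μ m] h) (i : ℕ) :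
    coeffFun m g i = coeffFun m h i :=
  integral_congr_ae (hgh.mono fun x hx => by simp only [hx])

theorem partialSumFun_congr_ae {g h : G m → ℂ} (hgh : g =ᵐ[μ m] h) (n : ℕ) :
    partialSumFun m n g = partialSumFun m n h := by
  funext x
  simp only [partialSumFun, coeffFun_congr_ae hgh]

/-- `S_{M_n} g` is the average of `g` over the intervals of rank `n`. -/
theorem partialSumFun_M (hm : ∀ k, 2 ≤ m k) {g : G m → ℂ} (hg : Integrable g (μ m)) (n : ℕ)
    (x : G m) : partialSumFun m (M m n) g x = M m n * ∫ y in interval m n x, g y ∂μ m := by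
  -- This is convolution with D_{M_n}: the support condition x - y ∈ I_n(0) means y ∈ I_n(x).
  have h1 : ∀ y, ∑ i ∈ Finset.range (M m n), g y * (starRingEnd ℂ) (psi m i y) * psi m i x =
      (M m n : ℂ) * (interval m n x).indicator g y := by
    intro y
    have h2 : ∀ i, g y * (starRingEnd ℂ) (psi m i y) * psi m i x = g y * psi m i (x - y) := by
      intro i; rw [psi_sub hm]; ring
    simp only [h2]
    rw [← Finset.mul_sum, sum_psi_M hm]
    have h3 : x - y ∈ interval m n 0 ↔ y ∈ interval m n x := by
      simp only [interval, Set.mem_ofPred_eq, Pi.sub_apply, Pi.zero_apply, sub_eq_zero]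
      exact forall₂_congr fun _ _ => eq_comm
    by_cases h4 : y ∈ interval m n x
    · rw [Set.indicator_of_mem h4, Set.indicator_of_mem (h3.2 h4)]; ring
    · rw [Set.indicator_of_notMem h4, Set.indicator_of_notMem (mt h3.1 h4)]; ring
  simp only [partialSumFun, coeffFun, ← integral_mul_const]
  rw [← integral_finsetSum _ fun i _ => (integrable_mul_conj_psi hm hg i).mul_const _]
  simp only [h1]
  rw [integral_const_mul, integral_indicator (measurableSet_interval m n x)]

/-- `S_{M_n}` fixes the functions of the first `n` coordinates. -/
theorem partialSumFun_M_of_dependsOn (hm : ∀ k, 2 ≤ m k) {g : G m → ℂ} (hg : Integrable g (μ m))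
    {n : ℕ} (h : DependsOn g (Set.Iio n)) : partialSumFun m (M m n) g = g := by
  funext x
  have := isProbabilityMeasure_μ hm
  rw [partialSumFun_M hm hg, setIntegral_congr_fun (g := fun _ => g x)
    (measurableSet_interval m n x) fun y hy => h fun i hi => hy i hi, setIntegral_const,
    measureReal_interval hm, Complex.real_smul]
  have : (M m n : ℂ) ≠ 0 := by exact_mod_cast (M_pos hm n).ne'
  push_cast
  field_simp

/-- The generators have this property, and it survives complements and countable unions. It allows
a.e. identities between F_n-measurable functions to be upgraded to identities everywhere. -/
theorem dependsOn_of_measurableSet {n : ℕ} {s : Set (G m)} (hs : MeasurableSet[sigma m n] s) :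
    DependsOn (· ∈ s) (Set.Iio n) := by
  induction s, hs using MeasurableSpace.generateFrom_induction with
  | hC t ht _ =>
    obtain ⟨x, rfl⟩ := ht
    intro y z hyz
    refine propext (forall₂_congr fun i hi => ?_)
    rw [hyz i hi]
  | empty => intro y z _; rfl
  | compl t _ ih =>
    intro y z hyz
    exact congrArg Not (ih hyz)
  | iUnion t _ ih =>
    intro y z hyz
    simp only [Set.mem_iUnion]
    exact propext (exists_congr fun i => iff_of_eq (ih i hyz))

theorem dependsOn_of_stronglyMeasurable {n : ℕ} {g : G m → ℂ}
    (hg : StronglyMeasurable[sigma m n] g) : DependsOn g (Set.Iio n) := by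
  intro x y hxy
  have h : (x ∈ g ⁻¹' {g y}) = (y ∈ g ⁻¹' {g y}) :=
    dependsOn_of_measurableSet (hg.measurable (measurableSet_singleton (g y))) hxy
  exact h.mpr rfl

theorem countable_range_interval (m : ℕ → ℕ) (n : ℕ) : (Set.range (interval m n)).Countable := by
  have hsub : Set.range (interval m n) ⊆ Set.range
      (fun z : (∀ i : Fin n, ZMod (m i)) => {y : G m | ∀ i : Fin n, y i = z i}) := by
    rintro _ ⟨x, rfl⟩
    refine ⟨fun i => x i, ?_⟩
    ext y
    exact ⟨fun hy i hi => hy ⟨i, hi⟩, fun hy i => hy i i.2⟩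
  have hz : ∀ k, Countable (ZMod k) := fun k => by
    cases k
    · exact inferInstanceAs (Countable ℤ)
    · exact inferInstanceAs (Countable (Fin _))
  exact Set.Countable.mono hsub (Set.countable_range _)

theorem stronglyMeasurable_of_dependsOn {n : ℕ} {g : G m → ℂ} (hg : DependsOn g (Set.Iio n)) :
    StronglyMeasurable[sigma m n] g := by
  suffices hmeas : Measurable[sigma m n] g from hmeas.stronglyMeasurable
  intro s _
  have h : g ⁻¹' s = ⋃₀ (interval m n '' (g ⁻¹' s)) := by
    ext y
    simp only [Set.mem_sUnion, Set.mem_image]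
    constructor
    · intro hy
      exact ⟨_, ⟨y, hy, rfl⟩, fun i _ => rfl⟩
    · rintro ⟨_, ⟨z, hz, rfl⟩, hy⟩
      have : g y = g z := hg fun i hi => hy i hi
      rwa [Set.mem_preimage, this]
  rw [h]
  refine MeasurableSet.sUnion ((countable_range_interval m n).mono (Set.image_subset_range _ _)) ?_
  rintro _ ⟨z, _, rfl⟩
  exact MeasurableSpace.measurableSet_generateFrom ⟨z, rfl⟩

theorem dependsOn_psi (hm : ∀ k, 2 ≤ m k) {i n : ℕ} (hi : i < M m n) :
    DependsOn (psi m i) (Set.Iio n) :=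
  fun _ _ h => psi_congr hm hi h

theorem dependsOn_partialSumFun (hm : ∀ k, 2 ≤ m k) {k n : ℕ} (hk : k ≤ M m n) (g : G m → ℂ) :
    DependsOn (partialSumFun m k g) (Set.Iio n) := by
  intro x y h
  refine Finset.sum_congr rfl fun i hi => ?_
  rw [dependsOn_psi hm ((Finset.mem_range.1 hi).trans_le hk) h]

/-- `S_n` is self-adjoint. -/
theorem integral_partialSumFun_mul_conj (hm : ∀ k, 2 ≤ m k) {g h : G m → ℂ}
    (hg : Integrable g (μ m)) (hh : Integrable h (μ m)) (n : ℕ) :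
    ∫ x, partialSumFun m n g x * (starRingEnd ℂ) (h x) ∂μ m =
      ∫ x, g x * (starRingEnd ℂ) (partialSumFun m n h x) ∂μ m := by
  simp only [partialSumFun, map_sum, map_mul, Finset.mul_sum, Finset.sum_mul]
  have key : ∀ i, (fun x => coeffFun m g i * psi m i x * (starRingEnd ℂ) (h x)) =
      fun x => coeffFun m g i * (starRingEnd ℂ) (h x * (starRingEnd ℂ) (psi m i x)) := by
    intro i; funext x; simp; ring
  have hint : ∀ i, Integrable
      (fun x => (starRingEnd ℂ) (h x * (starRingEnd ℂ) (psi m i x))) (μ m) := fun i =>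
    (Complex.conjCLE.toContinuousLinearMap.integrable_comp (integrable_mul_conj_psi hm hh i))
  have key2 : ∀ i, (fun x => g x * ((starRingEnd ℂ) (coeffFun m h i) *
      (starRingEnd ℂ) (psi m i x))) =
      fun x => (g x * (starRingEnd ℂ) (psi m i x)) * (starRingEnd ℂ) (coeffFun m h i) := by
    intro i; funext x; ring
  rw [integral_finsetSum, integral_finsetSum]
  · refine Finset.sum_congr rfl fun i _ => ?_
    rw [key, key2, integral_const_mul, integral_mul_const, integral_conj]
    rfl
  · intro i _
    rw [key2]
    exact (integrable_mul_conj_psi hm hg i).mul_const _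
  · intro i _
    rw [key]
    exact (hint i).const_mul _

/-- `S_{M_n} g` is the conditional expectation of `g` with respect to `F_n`. -/
theorem partialSumFun_M_ae_eq_condExp (hm : ∀ k, 2 ≤ m k) {g : G m → ℂ}
    (hg : Integrable g (μ m)) (n : ℕ) :
    partialSumFun m (M m n) g =ᵐ[μ m] (μ m)[g | filtration m n] := by
  have := isProbabilityMeasure_μ hm
  refine ae_eq_condExp_of_forall_setIntegral_eq ((filtration m).le n) hg
    (fun s _ _ => (integrable_partialSumFun hm _ g).integrableOn) (fun s hs _ => ?_)
    (StronglyMeasurable.aestronglyMeasurable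
      (stronglyMeasurable_of_dependsOn (dependsOn_partialSumFun hm le_rfl g)))
  have hs' : MeasurableSet s := (filtration m).le n s hs
  have hint : Integrable (s.indicator fun _ => (1 : ℂ)) (μ m) :=
    (integrable_const 1).indicator hs'
  have hdep : DependsOn (s.indicator fun _ => (1 : ℂ)) (Set.Iio n) := by
    classical
    intro x y h
    have h1 : (x ∈ s) = (y ∈ s) := dependsOn_of_measurableSet hs h
    simp only [Set.indicator_apply, h1]
  -- Self-adjointness moves S_{M_n} onto the indicator of s, which it fixes; this is the defining
  -- property of the conditional expectation.
  have key := integral_partialSumFun_mul_conj hm hg hint (M m n)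
  rw [partialSumFun_M_of_dependsOn hm hint hdep] at key
  have h1 : ∀ u : G m → ℂ, (fun x => u x * (starRingEnd ℂ) (s.indicator (fun _ => (1 : ℂ)) x)) =
      s.indicator u := by
    classical
    intro u; funext x
    simp only [Set.indicator_apply]
    split_ifs <;> simp
  rwa [h1, h1, integral_indicator hs', integral_indicator hs'] at key

theorem eLpNorm_partialSumFun_M_le (hm : ∀ k, 2 ≤ m k) {g : G m → ℂ}
    (hg : Integrable g (μ m)) (n : ℕ) :
    eLpNorm (partialSumFun m (M m n) g) 1 (μ m) ≤ eLpNorm g 1 (μ m) := by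
  rw [eLpNorm_congr_ae (partialSumFun_M_ae_eq_condExp hm hg n)]
  exact eLpNorm_condExp_le_eLpNorm _ le_rfl

/-- Orthogonality comes without product integrals: S_{M_n} reproduces ψ_j, so the squared moduli of
its coefficients sum to 1, and the j-th alone already accounts for 1. -/
theorem coeffFun_psi (hm : ∀ k, 2 ≤ m k) (i j : ℕ) :
    coeffFun m (psi m j) i = if i = j then 1 else 0 := by
  have := isProbabilityMeasure_μ hm
  have hself : ∀ j, coeffFun m (psi m j) j = 1 := fun j => by
    simp [coeffFun, psi_mul_conj hm]
  split_ifs with hij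
  · rw [hij, hself]
  -- Parseval: the squares of the coefficients of `psi m j` add up to `1`.
  obtain ⟨n, hi, hj⟩ : ∃ n, i < M m n ∧ j < M m n :=
    ⟨max i j, (le_max_left i j).trans_lt (lt_M hm _), (le_max_right i j).trans_lt (lt_M hm _)⟩
  have h1 := partialSumFun_M_of_dependsOn hm (integrable_psi hm j) (dependsOn_psi hm hj)
  have hsymm : ∀ k, coeffFun m (psi m k) j = (starRingEnd ℂ) (coeffFun m (psi m j) k) := by
    intro k
    rw [coeffFun, coeffFun, ← integral_conj]
    refine integral_congr_ae (ae_of_all _ fun x => ?_)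
    simp [mul_comm]
  have h2 : ∑ k ∈ Finset.range (M m n), ‖coeffFun m (psi m j) k‖ ^ 2 = 1 := by
    have h3 : coeffFun m (partialSumFun m (M m n) (psi m j)) j = 1 := by rw [h1, hself]
    unfold partialSumFun at h3
    rw [coeffFun_sum hm fun k _ => (integrable_psi hm k).const_mul _] at h3
    simp only [coeffFun_const_mul, hsymm, Complex.mul_conj, Complex.normSq_eq_norm_sq] at h3
    exact_mod_cast h3
  have hsub : ({i, j} : Finset ℕ) ⊆ Finset.range (M m n) := by
    intro k hk
    rcases Finset.mem_insert.1 hk with rfl | hk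
    · exact Finset.mem_range.2 hi
    · rw [Finset.mem_singleton.1 hk]; exact Finset.mem_range.2 hj
  have h4 := Finset.sum_le_sum_of_subset_of_nonneg hsub
    (f := fun k => ‖coeffFun m (psi m j) k‖ ^ 2) fun k _ _ => sq_nonneg _
  rw [Finset.sum_pair hij, h2, hself] at h4
  have h5 : ‖coeffFun m (psi m j) i‖ ^ 2 ≤ 0 := by
    have : ‖(1 : ℂ)‖ ^ 2 = 1 := by simp
    linarith
  have h6 : ‖coeffFun m (psi m j) i‖ = 0 := by
    have := sq_nonneg ‖coeffFun m (psi m j) i‖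
    exact pow_eq_zero_iff two_ne_zero |>.1 (le_antisymm h5 this)
  exact norm_eq_zero.1 h6

theorem coeffFun_sum_psi (hm : ∀ k, 2 ≤ m k) (s : Finset ℕ) (c : ℕ → ℂ) (i : ℕ) :
    coeffFun m (fun x => ∑ j ∈ s, c j * psi m j x) i = if i ∈ s then c i else 0 := by
  rw [coeffFun_sum hm fun k _ => (integrable_psi hm k).const_mul _]
  simp only [coeffFun_const_mul, coeffFun_psi hm, mul_ite, mul_one, mul_zero, Finset.sum_ite_eq]

theorem coeffFun_partialSumFun (hm : ∀ k, 2 ≤ m k) (n : ℕ) (g : G m → ℂ) (i : ℕ) :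
    coeffFun m (partialSumFun m n g) i = if i < n then coeffFun m g i else 0 := by
  unfold partialSumFun
  rw [coeffFun_sum_psi hm]
  simp only [Finset.mem_range]

theorem partialSumFun_partialSumFun (hm : ∀ k, 2 ≤ m k) (k n : ℕ) (g : G m → ℂ) :
    partialSumFun m k (partialSumFun m n g) = partialSumFun m (min k n) g := by
  funext x
  rw [partialSumFun]
  simp only [coeffFun_partialSumFun hm, ite_mul, zero_mul]
  rw [← Finset.sum_filter, partialSumFun]
  refine Finset.sum_congr ?_ fun _ _ => rfl
  ext i; simp

theorem partialSumFun_sub (hm : ∀ k, 2 ≤ m k) {g h : G m → ℂ} (hg : Integrable g (μ m))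
    (hh : Integrable h (μ m)) (n : ℕ) (x : G m) :
    partialSumFun m n (fun x => g x - h x) x = partialSumFun m n g x - partialSumFun m n h x := by
  simp only [partialSumFun, coeffFun_sub hm hg hh, sub_mul, Finset.sum_sub_distrib]

end Projection

/-! ### Limits of H_1 martingales and the modulus of continuity -/

section Hardy

variable {m : ℕ → ℕ} {f : ℕ → G m → ℂ} {F : G m → ℂ}

theorem enorm_le_maximal (f : ℕ → G m → ℂ) (n : ℕ) (x : G m) : ‖f n x‖ₑ ≤ maximal m f x :=
  le_iSup (fun n => ‖f n x‖ₑ) n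

theorem measurable_of_adapted (hf : StronglyAdapted (filtration m) f) (n : ℕ) :
    Measurable (f n) :=
  ((hf n).mono ((filtration m).le n)).measurable

theorem measurable_maximal (hf : ∀ n, Measurable (f n)) : Measurable (maximal m f) :=
  Measurable.iSup fun n => (hf n).enorm

theorem eLpNorm_le_hardyNorm (f : ℕ → G m → ℂ) (n : ℕ) :
    eLpNorm (f n) 1 (μ m) ≤ hardyNorm m f := by
  rw [eLpNorm_one_eq_lintegral_enorm]
  exact lintegral_mono fun x => enorm_le_maximal f n x

theorem martingale_clm_comp (hf : Martingale f (filtration m) (μ m)) (T : ℂ →L[ℝ] ℝ)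
    (hfi : ∀ n, Integrable (f n) (μ m)) :
    Martingale (fun n x => T (f n x)) (filtration m) (μ m) := by
  refine ⟨fun n => T.continuous.comp_stronglyMeasurable (hf.1 n), fun i j hij => ?_⟩
  filter_upwards [T.comp_condExp_comm (m := filtration m i) (hfi j), hf.2 i j hij] with x h1 h2
  have h3 : ((μ m)[fun x => T (f j x) | filtration m i]) x =
      T (((μ m)[f j | filtration m i]) x) := h1.symm
  rw [h3, h2]

/-- A martingale in `H_1` converges almost everywhere. -/
theorem exists_tendsto_of_clm (hm : ∀ k, 2 ≤ m k) (hf : MemHardy m f) (T : ℂ →L[ℝ] ℝ)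
    (hT : ∀ z, ‖T z‖ₑ ≤ ‖z‖ₑ) : ∀ᵐ x ∂μ m, ∃ c, Tendsto (fun n => T (f n x)) atTop (𝓝 c) := by
  have := isProbabilityMeasure_μ hm
  have hM := martingale_clm_comp hf.1 T hf.1.integrable
  refine hM.submartingale.exists_ae_tendsto_of_bdd (R := (hardyNorm m f).toNNReal) fun n => ?_
  rw [ENNReal.coe_toNNReal hf.2.ne]
  refine le_trans ?_ (eLpNorm_le_hardyNorm f n)
  rw [eLpNorm_one_eq_lintegral_enorm, eLpNorm_one_eq_lintegral_enorm]
  exact lintegral_mono fun x => hT _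

theorem ae_tendsto_limit (hm : ∀ k, 2 ≤ m k) (hf : MemHardy m f) :
    ∀ᵐ x ∂μ m, Tendsto (fun n => f n x) atTop (𝓝 (limit m f x)) := by
  have hle : ∀ (a : ℝ) (z : ℂ), |a| ≤ ‖z‖ → ‖a‖ₑ ≤ ‖z‖ₑ := fun a z h => by
    rw [enorm_le_iff_norm_le, Real.norm_eq_abs]; exact h
  filter_upwards [exists_tendsto_of_clm hm hf Complex.reCLM fun z => hle _ _ z.abs_re_le_norm,
    exists_tendsto_of_clm hm hf Complex.imCLM fun z => hle _ _ z.abs_im_le_norm] with x h1 h2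
  obtain ⟨a, ha⟩ := h1
  obtain ⟨b, hb⟩ := h2
  refine tendsto_nhds_limUnder ⟨(a : ℂ) + b * Complex.I, ?_⟩
  have h3 : (fun n => f n x) =
      fun n => ((Complex.reCLM (f n x) : ℝ) : ℂ) + ((Complex.imCLM (f n x) : ℝ) : ℂ) * Complex.I := by
    funext n; simp
  rw [h3]
  exact ((Complex.continuous_ofReal.tendsto a).comp ha).add
    (((Complex.continuous_ofReal.tendsto b).comp hb).mul_const _)

/-- A martingale in `H_1` is represented by its almost everywhere limit. -/
theorem represents_limit (hm : ∀ k, 2 ≤ m k) (hf : MemHardy m f) :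
    Represents m (limit m f) f := by
  have := isProbabilityMeasure_μ hm
  have hlim := ae_tendsto_limit hm hf
  have hmeas := measurable_of_adapted hf.1.1
  have hmax := measurable_maximal hmeas
  have hfin : ∀ᵐ x ∂μ m, maximal m f x < ∞ := ae_lt_top hmax hf.2.ne
  have hb : Integrable (fun x => (maximal m f x).toReal) (μ m) :=
    integrable_toReal_of_lintegral_ne_top hmax.aemeasurable hf.2.ne
  have hbd : ∀ n, ∀ᵐ x ∂μ m, ‖f n x‖ ≤ (maximal m f x).toReal := fun n => by
    filter_upwards [hfin] with x hx
    rw [← toReal_enorm]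
    exact ENNReal.toReal_mono hx.ne (enorm_le_maximal f n x)
  have hL : Integrable (limit m f) (μ m) := by
    refine hb.mono' (aestronglyMeasurable_of_tendsto_ae atTop
      (fun n => (hmeas n).aestronglyMeasurable) hlim) ?_
    filter_upwards [hlim, ae_all_iff.2 hbd] with x h1 h2
    exact le_of_tendsto h1.norm (Eventually.of_forall h2)
  refine ⟨memLp_one_iff_integrable.2 hL, hlim, fun n => ?_⟩
  have hself : (μ m)[f n | filtration m n] = f n :=
    condExp_of_stronglyMeasurable ((filtration m).le n) (hf.1.1 n) (hf.1.integrable n)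
  -- Dominated convergence, with the maximal function as majorant, in E[f_{k+n} | F_n] = f_n. The
  -- shift by n makes this hold for every k; the second sequence is constant.
  have key := tendsto_condExp_unique (m := filtration m n) (μ := μ m) (fun k => f (k + n))
    (fun _ => f n) (limit m f) (f n) (fun k => hf.1.integrable _) (fun _ => hf.1.integrable n)
    (hlim.mono fun x hx => hx.comp (tendsto_add_atTop_nat n))
    (ae_of_all _ fun x => tendsto_const_nhds) _ hb _ hb (fun k => hbd _) (fun _ => hbd n)
    (fun k => by rw [hself]; exact hf.1.2 n (k + n) (Nat.le_add_left _ _))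
  rwa [hself] at key

/-- Equality holds everywhere: f_n is fixed by S_{M_n}, and S_{M_n} depends only on the a.e. class
of its argument. -/
theorem eq_partialSumFun_of_represents (hm : ∀ k, 2 ≤ m k) (hf : MemHardy m f)
    (hF : Represents m F f) (n : ℕ) : f n = partialSumFun m (M m n) F := by
  have hFi : Integrable F (μ m) := memLp_one_iff_integrable.1 hF.1
  have h1 : partialSumFun m (M m n) F =ᵐ[μ m] f n :=
    (partialSumFun_M_ae_eq_condExp hm hFi n).trans (hF.2.2 n)
  rw [← partialSumFun_M_of_dependsOn hm (hf.1.integrable n)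
    (dependsOn_of_stronglyMeasurable (hf.1.1 n)), ← partialSumFun_congr_ae h1,
    partialSumFun_partialSumFun hm, min_self]

theorem coeff_eq_coeffFun (hm : ∀ k, 2 ≤ m k) (hf : MemHardy m f) (hF : Represents m F f)
    (i : ℕ) : coeff m f i = coeffFun m F i := by
  refine Tendsto.limUnder_eq (tendsto_const_nhds.congr' ?_)
  filter_upwards [eventually_ge_atTop i] with k hk
  rw [eq_partialSumFun_of_represents hm hf hF, coeffFun_partialSumFun hm,
    if_pos (hk.trans_lt (lt_M hm k))]

theorem partialSum_eq_partialSumFun (hm : ∀ k, 2 ≤ m k) (hf : MemHardy m f)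
    (hF : Represents m F f) (n : ℕ) : partialSum m n f = partialSumFun m n F := by
  funext x
  simp only [partialSum, partialSumFun, coeff_eq_coeffFun hm hf hF]

/-- Since S_{M_k} S_{M_n} = S_{M_{min(k,n)}}, the martingale attached to S_{M_n}f is f stopped at n.
-/
theorem toMartingale_partialSum (hm : ∀ k, 2 ≤ m k) (hf : MemHardy m f)
    (n k : ℕ) : toMartingale m (partialSum m (M m n) f) k = f (min k n) := by
  have hF := represents_limit hm hf
  rw [partialSum_eq_partialSumFun hm hf hF, toMartingale, partialSumFun_partialSumFun hm,
    eq_partialSumFun_of_represents hm hf hF, (M_strictMono hm).monotone.map_min]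

theorem modulus_eq (hm : ∀ k, 2 ≤ m k) (hf : MemHardy m f) (n : ℕ) :
    modulus m n f = hardyNorm m fun k x => f k x - f (min k n) x := by
  simp only [modulus, toMartingale_partialSum hm hf]

theorem modulus_lt_top (hm : ∀ k, 2 ≤ m k) (hf : MemHardy m f) (n : ℕ) :
    modulus m n f < ∞ := by
  rw [modulus_eq hm hf]
  calc hardyNorm m (fun k x => f k x - f (min k n) x)
      ≤ ∫⁻ x, (maximal m f x + maximal m f x) ∂μ m :=
        lintegral_mono fun x => iSup_le fun k => (enorm_sub_le).trans
          (add_le_add (enorm_le_maximal f _ x) (enorm_le_maximal f _ x))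
    _ = hardyNorm m f + hardyNorm m f :=
        lintegral_add_left (measurable_maximal (measurable_of_adapted hf.1.1)) _
    _ < ∞ := ENNReal.add_lt_top.2 ⟨hf.2, hf.2⟩

/-- For k ≥ n the difference martingale is f_k - f_n, which tends to F - f_n a.e., so its maximal
function dominates the limit. -/
theorem eLpNorm_sub_le_modulus (hm : ∀ k, 2 ≤ m k) (hf : MemHardy m f)
    (hF : Represents m F f) (n : ℕ) :
    eLpNorm (fun x => F x - f n x) 1 (μ m) ≤ modulus m n f := by
  rw [modulus_eq hm hf, eLpNorm_one_eq_lintegral_enorm]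
  refine lintegral_mono_ae ?_
  filter_upwards [hF.2.1] with x hx
  refine le_of_tendsto (hx.sub_const (f n x)).enorm ?_
  filter_upwards [eventually_ge_atTop n] with k hk
  refine le_trans (le_of_eq ?_)
    (enorm_le_maximal (fun k x => f k x - f (min k n) x) k x)
  simp only [min_eq_right hk]

end Hardy

/-! ### Logarithmic growth of the Lebesgue constants, and convergence -/

section Lebesgue

variable {m : ℕ → ℕ}

/-- Since ψ_{cM_j+i} = ψ_{cM_j} ψ_i, a block of the series starting at c M_j is a modulated initial
partial sum. Modulation preserves L_1 norms, so blocks inherit the bounds for S_n. -/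
theorem sum_shift_eq (hm : ∀ k, 2 ≤ m k) (g : G m → ℂ) (c : ℕ) {n j : ℕ} (hn : n ≤ M m j)
    (x : G m) :
    ∑ i ∈ Finset.range n, coeffFun m g (c * M m j + i) * psi m (c * M m j + i) x =
      psi m (c * M m j) x *
        partialSumFun m n (fun y => g y * (starRingEnd ℂ) (psi m (c * M m j) y)) x := by
  rw [partialSumFun, Finset.mul_sum]
  refine Finset.sum_congr rfl fun i hi => ?_
  have hi' := (Finset.mem_range.1 hi).trans_le hn
  have h1 : coeffFun m (fun y => g y * (starRingEnd ℂ) (psi m (c * M m j) y)) i =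
      coeffFun m g (c * M m j + i) := by
    simp only [coeffFun, psi_add hm c j hi', map_mul, mul_assoc]
  rw [h1, psi_add hm c j hi']
  ring

theorem eLpNorm_sum_shift_le (hm : ∀ k, 2 ≤ m k) {C : ℝ≥0∞} {n j : ℕ} (hn : n ≤ M m j)
    (hC : ∀ g : G m → ℂ, Integrable g (μ m) →
      eLpNorm (partialSumFun m n g) 1 (μ m) ≤ C * eLpNorm g 1 (μ m))
    {g : G m → ℂ} (hg : Integrable g (μ m)) (c : ℕ) :
    eLpNorm (fun x => ∑ i ∈ Finset.range n,
      coeffFun m g (c * M m j + i) * psi m (c * M m j + i) x) 1 (μ m) ≤ C * eLpNorm g 1 (μ m) := by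
  simp only [sum_shift_eq hm g c hn]
  have h1 := hC _ (integrable_mul_conj_psi hm hg (c * M m j))
  have h2 : eLpNorm (fun y => g y * (starRingEnd ℂ) (psi m (c * M m j) y)) 1 (μ m) =
      eLpNorm g 1 (μ m) :=
    eLpNorm_congr_norm_ae (ae_of_all _ fun y => by simp [norm_psi hm])
  rw [h2] at h1
  refine le_trans (le_of_eq ?_) h1
  exact eLpNorm_congr_norm_ae (ae_of_all _ fun y => by simp [norm_psi hm])

/-- For bounded `m` the operators `S_n`, `n < M_N`, have norm `O(N)` on `L_1`. -/
theorem eLpNorm_partialSumFun_le (hm : ∀ k, 2 ≤ m k) {B : ℕ} (hB : ∀ k, m k ≤ B) (N : ℕ) :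
    ∀ n < M m N, ∀ g : G m → ℂ, Integrable g (μ m) →
      eLpNorm (partialSumFun m n g) 1 (μ m) ≤ (B * N : ℕ) * eLpNorm g 1 (μ m) := by
  induction N with
  | zero =>
    intro n hn g _
    obtain rfl : n = 0 := by simpa [M] using hn
    have : partialSumFun m 0 g = 0 := by funext x; simp [partialSumFun]
    simp [this]
  | succ N ih =>
    intro n hn g hg
    set a := n / M m N
    set r := n % M m N
    have hr : r < M m N := Nat.mod_lt _ (M_pos hm N)
    -- Boundedness of m enters here: the leading digit counts the full blocks, each of norm at most
    -- 1, so a level costs at most B.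
    have ha : a ≤ B := ((Nat.div_lt_iff_lt_mul (M_pos hm N)).2 hn).le.trans (hB N)
    have hn' : n = a * M m N + r := (Nat.div_add_mod' n _).symm
    let block : ℕ → ℕ → G m → ℂ := fun l c x => ∑ i ∈ Finset.range l,
      coeffFun m g (c * M m N + i) * psi m (c * M m N + i) x
    have hmeas : ∀ l c, AEStronglyMeasurable (block l c) (μ m) := fun l c =>
      (Finset.measurable_fun_sum _ fun i _ =>
        (measurable_psi m _).const_mul _).aestronglyMeasurable
    have hsplit : partialSumFun m n g = (∑ c ∈ Finset.range a, block (M m N) c) + block r a := by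
      funext x
      rw [partialSumFun, hn', Finset.sum_range_add, sum_range_mul_M, Pi.add_apply,
        Finset.sum_apply]
    have hfull : ∀ c, eLpNorm (block (M m N) c) 1 (μ m) ≤ eLpNorm g 1 (μ m) := fun c => by
      have := eLpNorm_sum_shift_le hm (C := 1) (le_refl (M m N))
        (fun g hg => by rw [one_mul]; exact eLpNorm_partialSumFun_M_le hm hg N) hg c
      rwa [one_mul] at this
    calc eLpNorm (partialSumFun m n g) 1 (μ m)
        ≤ eLpNorm (∑ c ∈ Finset.range a, block (M m N) c) 1 (μ m) +
            eLpNorm (block r a) 1 (μ m) := by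
          rw [hsplit]
          exact eLpNorm_add_le (Finset.aestronglyMeasurable_sum _ fun c _ => hmeas _ c)
            (hmeas _ _) le_rfl
      _ ≤ ∑ c ∈ Finset.range a, eLpNorm g 1 (μ m) + (B * N : ℕ) * eLpNorm g 1 (μ m) := by
          refine add_le_add ((eLpNorm_sum_le (fun c _ => hmeas _ c) le_rfl).trans
            (Finset.sum_le_sum fun c _ => hfull c)) ?_
          exact eLpNorm_sum_shift_le hm hr.le (fun g hg => ih r hr g hg) hg a
      _ = ((a + B * N : ℕ) : ℝ≥0∞) * eLpNorm g 1 (μ m) := by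
          rw [Finset.sum_const, Finset.card_range, nsmul_eq_mul]; push_cast; ring
      _ ≤ (B * (N + 1) : ℕ) * eLpNorm g 1 (μ m) := by
          gcongr
          rw [Nat.mul_succ]; omega

/-- The rank of `k`: the largest `j` with `M_j ≤ k`, if `k` is positive. -/
def rank (m : ℕ → ℕ) (k : ℕ) : ℕ := Nat.findGreatest (fun j => M m j ≤ k) k

theorem M_rank_le {k : ℕ} (hk : 1 ≤ k) : M m (rank m k) ≤ k :=
  Nat.findGreatest_spec (P := fun j => M m j ≤ k) (Nat.zero_le k) hk

theorem lt_M_rank_succ (hm : ∀ k, 2 ≤ m k) (k : ℕ) : k < M m (rank m k + 1) := by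
  by_contra! h
  -- The search in `rank` is capped at k, which excludes nothing because j < M_j.
  have h1 : rank m k + 1 ≤ rank m k :=
    Nat.le_findGreatest (P := fun j => M m j ≤ k) ((lt_M hm _).le.trans h) h
  omega

theorem rank_eq (hm : ∀ k, 2 ≤ m k) {j k : ℕ} (h1 : M m j ≤ k) (h2 : k < M m (j + 1)) :
    rank m k = j := by
  have h3 := M_rank_le (m := m) ((M_pos hm j).trans_le h1)
  have h4 := lt_M_rank_succ hm k
  have h5 := (M_strictMono hm).lt_iff_lt.1 (h1.trans_lt h4)
  have h6 := (M_strictMono hm).lt_iff_lt.1 (h3.trans_lt h2)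
  omega

theorem tendsto_rank (hm : ∀ k, 2 ≤ m k) : Tendsto (rank m) atTop atTop := by
  refine tendsto_atTop.2 fun N => ?_
  filter_upwards [eventually_ge_atTop (M m N)] with k hk
  have := (M_strictMono hm).lt_iff_lt.1 (hk.trans_lt (lt_M_rank_succ hm k))
  omega

/-- As M_N ≤ k for N the rank of k, S_k fixes f_N, and only F - f_N contributes to the error. -/
theorem eLpNorm_partialSum_sub_le (hm : ∀ k, 2 ≤ m k) {B : ℕ} (hB : ∀ k, m k ≤ B)
    {f : ℕ → G m → ℂ} (hf : MemHardy m f) {F : G m → ℂ} (hF : Represents m F f) {k : ℕ}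
    (hk : 1 ≤ k) :
    eLpNorm (fun x => partialSum m k f x - F x) 1 (μ m) ≤
      (B * (rank m k + 1) + 1 : ℕ) * modulus m (rank m k) f := by
  set N := rank m k
  have hFi : Integrable F (μ m) := memLp_one_iff_integrable.1 hF.1
  have hgi : Integrable (fun x => F x - f N x) (μ m) := hFi.sub (hf.1.integrable N)
  have h1 : (fun x => partialSum m k f x - F x) =
      partialSumFun m k (fun x => F x - f N x) - fun x => F x - f N x := by
    funext x
    have h2 : partialSumFun m k (f N) = f N := by
      rw [eq_partialSumFun_of_represents hm hf hF, partialSumFun_partialSumFun hm,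
        min_eq_right (M_rank_le hk)]
    rw [Pi.sub_apply, partialSumFun_sub hm hFi (hf.1.integrable N), h2,
      partialSum_eq_partialSumFun hm hf hF]
    ring
  have h3 := eLpNorm_partialSumFun_le hm hB (N + 1) k (lt_M_rank_succ hm k) _ hgi
  calc eLpNorm (fun x => partialSum m k f x - F x) 1 (μ m)
      ≤ eLpNorm (partialSumFun m k (fun x => F x - f N x)) 1 (μ m) +
          eLpNorm (fun x => F x - f N x) 1 (μ m) := by
        rw [h1]
        exact eLpNorm_sub_le (integrable_partialSumFun hm _ _).1 hgi.1 le_rfl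
    _ ≤ (B * (N + 1) : ℕ) * eLpNorm (fun x => F x - f N x) 1 (μ m) +
          eLpNorm (fun x => F x - f N x) 1 (μ m) := by gcongr
    _ = (B * (N + 1) + 1 : ℕ) * eLpNorm (fun x => F x - f N x) 1 (μ m) := by push_cast; ring
    _ ≤ (B * (N + 1) + 1 : ℕ) * modulus m N f := by
        gcongr; exact eLpNorm_sub_le_modulus hm hf hF N

theorem tendsto_partialSum_of_modulus_isLittleO (hm : ∀ k, 2 ≤ m k) {B : ℕ} (hB : ∀ k, m k ≤ B)
    {f : ℕ → G m → ℂ} (hf : MemHardy m f)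
    (ho : (fun n => (modulus m n f).toReal) =o[atTop] (fun n : ℕ => 1 / (n : ℝ)))
    {F : G m → ℂ} (hF : Represents m F f) :
    Tendsto (fun k => eLpNorm (fun x => partialSum m k f x - F x) 1 (μ m)) atTop (𝓝 0) := by
  have hbig : (fun n : ℕ => ((B * (n + 1) + 1 : ℕ) : ℝ)) =O[atTop] (fun n : ℕ => (n : ℝ)) := by
    refine IsBigO.of_bound (2 * B + 1) ?_
    filter_upwards [eventually_ge_atTop 1] with n hn
    rw [Real.norm_natCast, Real.norm_natCast]
    have : B * (n + 1) + 1 ≤ (2 * B + 1) * n := by nlinarith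
    exact_mod_cast this
  have h1 : Tendsto (fun n : ℕ => ((B * (n + 1) + 1 : ℕ) : ℝ) * (modulus m n f).toReal)
      atTop (𝓝 0) := by
    refine (isLittleO_one_iff ℝ).1 ((hbig.mul_isLittleO ho).trans_isBigO ?_)
    refine IsBigO.of_bound 1 (Eventually.of_forall fun n => ?_)
    -- At n = 0 the product n * (1 / n) is 0 rather than 1, so it is only bounded by 1.
    rcases eq_or_ne (n : ℝ) 0 with h | h
    · simp [h]
    · rw [mul_one_div_cancel h]; simp
  have h2 : Tendsto (fun n : ℕ => ((B * (n + 1) + 1 : ℕ) : ℝ≥0∞) * modulus m n f)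
      atTop (𝓝 0) := by
    have h3 := ENNReal.tendsto_ofReal h1
    rw [ENNReal.ofReal_zero] at h3
    refine h3.congr fun n => ?_
    rw [ENNReal.ofReal_mul (Nat.cast_nonneg _), ENNReal.ofReal_natCast,
      ENNReal.ofReal_toReal (modulus_lt_top hm hf n).ne]
  refine tendsto_of_tendsto_of_tendsto_of_le_of_le' tendsto_const_nhds
    (h2.comp (tendsto_rank hm)) (Eventually.of_forall fun _ => zero_le) ?_
  filter_upwards [eventually_ge_atTop 1] with k hk
  exact eLpNorm_partialSum_sub_le hm hB hf hF hk

end Lebesgue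

/-! ### Dirichlet kernels with large L_1 norm -/

section DirichletLower

variable {m : ℕ → ℕ}

theorem lintegral_enorm_sum_psi_M (hm : ∀ k, 2 ≤ m k) (n : ℕ) :
    ∫⁻ x, ‖∑ i ∈ Finset.range (M m n), psi m i x‖ₑ ∂μ m = 1 := by
  simp only [sum_psi_M hm, enorm_indicator_eq_indicator_enorm]
  rw [lintegral_indicator (measurableSet_interval m n 0), setLIntegral_const,
    measure_interval hm, ← ofReal_norm, Complex.norm_natCast, ENNReal.ofReal_natCast]
  exact ENNReal.mul_inv_cancel (by exact_mod_cast (M_pos hm n).ne') (ENNReal.natCast_ne_top _)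

/-- The index `∑_{i < K} (m_{2i} - 1) M_{2i}`, whose Dirichlet kernel has a norm of order `K`. -/
def alternatingIndex (m : ℕ → ℕ) : ℕ → ℕ
  | 0 => 0
  | K + 1 => (m (2 * K) - 1) * M m (2 * K) + alternatingIndex m K

theorem alternatingIndex_lt (hm : ∀ k, 2 ≤ m k) (K : ℕ) :
    alternatingIndex m K < M m (2 * K) := by
  induction K with
  | zero => exact M_pos hm 0
  | succ K ih =>
    have h1 : M m (2 * K + 1) < M m (2 * (K + 1)) := M_strictMono hm (by omega)
    have h2 := pred_mul_M_add_M hm (2 * K)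
    rw [alternatingIndex]
    omega

theorem alternatingIndex_succ_lt (hm : ∀ k, 2 ≤ m k) (K : ℕ) :
    alternatingIndex m (K + 1) < M m (2 * K + 1) := by
  have h1 := alternatingIndex_lt hm K
  have h2 := pred_mul_M_add_M hm (2 * K)
  rw [alternatingIndex]
  omega

/-- The digit m_{2K} - 1, rather than 1, makes the index comparable to M_{2K+1} uniformly in m; this
is what covers unbounded m. -/
theorem M_le_two_mul_alternatingIndex (hm : ∀ k, 2 ≤ m k) (K : ℕ) :
    M m (2 * K + 1) ≤ 2 * alternatingIndex m (K + 1) := by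
  have h1 : m (2 * K) ≤ 2 * (m (2 * K) - 1) := by have := hm (2 * K); omega
  calc M m (2 * K + 1) ≤ 2 * (m (2 * K) - 1) * M m (2 * K) := Nat.mul_le_mul_right _ h1
    _ = 2 * ((m (2 * K) - 1) * M m (2 * K)) := mul_assoc _ _ _
    _ ≤ 2 * alternatingIndex m (K + 1) := Nat.mul_le_mul_left _ (Nat.le_add_right _ _)

/-- The shell `I_{2i+1}(0) \ I_{2i+2}(0)`. -/
def shell (m : ℕ → ℕ) (i : ℕ) : Set (G m) := interval m (2 * i + 1) 0 \ interval m (2 * i + 2) 0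

theorem measurableSet_shell (m : ℕ → ℕ) (i : ℕ) : MeasurableSet (shell m i) :=
  (measurableSet_interval m _ _).diff (measurableSet_interval m _ _)

theorem interval_anti (m : ℕ → ℕ) {j k : ℕ} (h : j ≤ k) (x : G m) :
    interval m k x ⊆ interval m j x := fun _ hy i hi => hy i (hi.trans_le h)

/-- Off I_{2i+2}(0) the full blocks of length M_{2j} with j > i vanish. What is left is, up to a
unimodular factor, a sum of characters of index below M_{2i+1}, all equal to 1 on I_{2i+1}(0). -/
theorem norm_sum_psi_alternatingIndex (hm : ∀ k, 2 ≤ m k) {i K : ℕ} (hi : i < K) {x : G m}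
    (hx : x ∈ shell m i) :
    ‖∑ t ∈ Finset.range (alternatingIndex m K), psi m t x‖ = alternatingIndex m (i + 1) := by
  induction K with
  | zero => omega
  | succ K ih =>
    rcases Nat.lt_succ_iff_lt_or_eq.1 hi with h | rfl
    · have h0 : ∀ c, ∑ t ∈ Finset.range (M m (2 * K)), psi m (c * M m (2 * K) + t) x = 0 := by
        intro c
        rw [Finset.sum_congr rfl fun t ht => psi_add hm c (2 * K) (Finset.mem_range.1 ht) x,
          ← Finset.mul_sum, sum_psi_M hm, Set.indicator_of_notMem, mul_zero]
        exact fun h' => hx.2 (interval_anti m (by omega) 0 h')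
      rw [alternatingIndex, Finset.sum_range_add, sum_range_mul_M,
        Finset.sum_eq_zero fun c _ => h0 c, zero_add,
        Finset.sum_congr rfl fun t ht => psi_add hm _ (2 * K)
          ((Finset.mem_range.1 ht).trans (alternatingIndex_lt hm K)) x,
        ← Finset.mul_sum, norm_mul, norm_psi hm, one_mul, ih h]
    · have h1 : ∀ t ∈ Finset.range (alternatingIndex m (i + 1)), psi m t x = 1 := by
        intro t ht
        have ht' := (Finset.mem_range.1 ht).trans (alternatingIndex_succ_lt hm i)
        rw [psi_congr hm ht' (y := 0) fun j hj => hx.1 j hj]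
        simp [psi, rademacher]
      rw [Finset.sum_congr rfl h1]
      simp

theorem le_measureReal_shell (hm : ∀ k, 2 ≤ m k) (i : ℕ) :
    (2 * M m (2 * i + 1) : ℝ)⁻¹ ≤ (μ m).real (shell m i) := by
  have := isProbabilityMeasure_μ hm
  have h1 : (0 : ℝ) < M m (2 * i + 1) := by exact_mod_cast M_pos hm _
  have h2 : (2 * M m (2 * i + 1) : ℝ) ≤ M m (2 * i + 2) := by
    exact_mod_cast two_mul_M_le hm (2 * i + 1)
  rw [shell, measureReal_sdiff (interval_anti m (by omega) 0) (measurableSet_interval m _ _),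
    measureReal_interval hm, measureReal_interval hm]
  have h3 : (M m (2 * i + 2) : ℝ)⁻¹ ≤ (2 * M m (2 * i + 1) : ℝ)⁻¹ := inv_anti₀ (by positivity) h2
  have h4 : (M m (2 * i + 1) : ℝ)⁻¹ = 2 * (2 * M m (2 * i + 1) : ℝ)⁻¹ := by field_simp
  linarith

theorem disjoint_shell (m : ℕ → ℕ) {i j : ℕ} (h : i < j) : Disjoint (shell m i) (shell m j) :=
  Set.disjoint_left.2 fun _ hx hy => hx.2 (interval_anti m (by omega) 0 hy.1)

/-- On the i-th shell the kernel has modulus at least M_{2i+1}/2 and the shell has measure at least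
1/(2M_{2i+1}), so each of the K disjoint shells contributes 1/4. -/
theorem le_lintegral_enorm_sum_psi (hm : ∀ k, 2 ≤ m k) (K : ℕ) :
    (K : ℝ≥0∞) * 4⁻¹ ≤
      ∫⁻ x, ‖∑ t ∈ Finset.range (alternatingIndex m K), psi m t x‖ₑ ∂μ m := by
  have := isProbabilityMeasure_μ hm
  have hshell : ∀ i ∈ Finset.range K, (4⁻¹ : ℝ≥0∞) ≤
      ∫⁻ x in shell m i, ‖∑ t ∈ Finset.range (alternatingIndex m K), psi m t x‖ₑ ∂μ m := by
    intro i hi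
    rw [setLIntegral_congr_fun (g := fun _ => ENNReal.ofReal (alternatingIndex m (i + 1)))
      (measurableSet_shell m i) fun x hx => by
        simp only [← ofReal_norm,
          norm_sum_psi_alternatingIndex hm (Finset.mem_range.1 hi) hx],
      setLIntegral_const, ← ofReal_measureReal, ← ENNReal.ofReal_mul (Nat.cast_nonneg _)]
    have h1 : (4⁻¹ : ℝ≥0∞) = ENNReal.ofReal 4⁻¹ := by
      rw [ENNReal.ofReal_inv_of_pos (by norm_num)]; simp
    rw [h1]
    apply ENNReal.ofReal_le_ofReal
    have h2 : (0 : ℝ) < M m (2 * i + 1) := by exact_mod_cast M_pos hm _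
    have h3 : (M m (2 * i + 1) : ℝ) ≤ 2 * alternatingIndex m (i + 1) := by
      exact_mod_cast M_le_two_mul_alternatingIndex hm i
    calc (4⁻¹ : ℝ) = (M m (2 * i + 1) / 2) * (2 * M m (2 * i + 1) : ℝ)⁻¹ := by
          field_simp; norm_num
      _ ≤ alternatingIndex m (i + 1) * (μ m).real (shell m i) :=
          mul_le_mul (by linarith) (le_measureReal_shell hm i) (by positivity) (by positivity)
  calc (K : ℝ≥0∞) * 4⁻¹ = ∑ i ∈ Finset.range K, (4⁻¹ : ℝ≥0∞) := by simp
    _ ≤ ∑ i ∈ Finset.range K, ∫⁻ x in shell m i,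
          ‖∑ t ∈ Finset.range (alternatingIndex m K), psi m t x‖ₑ ∂μ m := Finset.sum_le_sum hshell
    _ = ∫⁻ x in ⋃ i ∈ Finset.range K, shell m i,
          ‖∑ t ∈ Finset.range (alternatingIndex m K), psi m t x‖ₑ ∂μ m := by
        rw [lintegral_biUnion_finset _ fun i _ => measurableSet_shell m i]
        intro i _ j _ hij
        rcases lt_or_gt_of_ne hij with h | h
        · exact disjoint_shell m h
        · exact (disjoint_shell m h).symm
    _ ≤ _ := setLIntegral_le_lintegral _ _

end DirichletLower

/-! ### The lacunary counterexample -/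

section Lacunary

variable {m : ℕ → ℕ}

open Classical in
/-- The coefficient `1 / M_k` at the levels `j = 2 M_k`, and `0` at the other levels. -/
noncomputable def levelCoeff (m : ℕ → ℕ) (j : ℕ) : ℂ :=
  if ∃ k, j = 2 * M m k then 2 / (j : ℂ) else 0

/-- The martingale whose `i`-th coefficient is `1 / M_k` for `M_{2M_k} ≤ i < M_{2M_k+1}`, and `0`
for all other `i`. -/
noncomputable def lacunary (m : ℕ → ℕ) (n : ℕ) (x : G m) : ℂ :=
  ∑ i ∈ Finset.range (M m n), levelCoeff m (rank m i) * psi m i x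

/-- The difference of the Dirichlet kernels of indices `M_{n+1}` and `M_n`. -/
noncomputable def kernelDiff (m : ℕ → ℕ) (n : ℕ) (x : G m) : ℂ :=
  ∑ i ∈ Finset.range (M m (n + 1)), psi m i x - ∑ i ∈ Finset.range (M m n), psi m i x

theorem measurable_kernelDiff (m : ℕ → ℕ) (n : ℕ) : Measurable (kernelDiff m n) :=
  (Finset.measurable_fun_sum _ fun i _ => measurable_psi m i).sub
    (Finset.measurable_fun_sum _ fun i _ => measurable_psi m i)

theorem lintegral_enorm_kernelDiff_le (hm : ∀ k, 2 ≤ m k) (n : ℕ) :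
    ∫⁻ x, ‖kernelDiff m n x‖ₑ ∂μ m ≤ 2 := by
  calc ∫⁻ x, ‖kernelDiff m n x‖ₑ ∂μ m
      ≤ ∫⁻ x, (‖∑ i ∈ Finset.range (M m (n + 1)), psi m i x‖ₑ +
          ‖∑ i ∈ Finset.range (M m n), psi m i x‖ₑ) ∂μ m := lintegral_mono fun x => enorm_sub_le
    _ = 2 := by
        rw [lintegral_add_left
          (Finset.measurable_fun_sum _ fun i _ => measurable_psi m i).enorm,
          lintegral_enorm_sum_psi_M hm, lintegral_enorm_sum_psi_M hm, one_add_one_eq_two]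

theorem levelCoeff_two_mul_M (hm : ∀ k, 2 ≤ m k) (k : ℕ) :
    levelCoeff m (2 * M m k) = (M m k : ℂ)⁻¹ := by
  have h : (M m k : ℂ) ≠ 0 := by exact_mod_cast (M_pos hm k).ne'
  rw [levelCoeff, if_pos ⟨k, rfl⟩]
  push_cast
  field_simp

theorem enorm_levelCoeff_two_mul_M (hm : ∀ k, 2 ≤ m k) (k : ℕ) :
    ‖levelCoeff m (2 * M m k)‖ₑ = (M m k : ℝ≥0∞)⁻¹ := by
  have h : (0 : ℝ) < M m k := by exact_mod_cast M_pos hm k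
  rw [levelCoeff_two_mul_M hm, ← ofReal_norm, norm_inv, Complex.norm_natCast,
    ENNReal.ofReal_inv_of_pos h, ENNReal.ofReal_natCast]

theorem levelCoeff_zero (hm : ∀ k, 2 ≤ m k) : levelCoeff m 0 = 0 :=
  if_neg fun ⟨k, hk⟩ => by have := M_pos hm k; omega

theorem lacunary_zero (hm : ∀ k, 2 ≤ m k) (x : G m) : lacunary m 0 x = 0 := by
  simp [lacunary, M, rank, levelCoeff_zero hm]

theorem lacunary_succ (hm : ∀ k, 2 ≤ m k) (n : ℕ) (x : G m) :
    lacunary m (n + 1) x = lacunary m n x + levelCoeff m n * kernelDiff m n x := by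
  have hle : M m n ≤ M m (n + 1) := (M_strictMono hm).monotone (Nat.le_succ n)
  have h1 : ∀ i ∈ Finset.Ico (M m n) (M m (n + 1)),
      levelCoeff m (rank m i) * psi m i x = levelCoeff m n * psi m i x := fun i hi => by
    rw [rank_eq hm (Finset.mem_Ico.1 hi).1 (Finset.mem_Ico.1 hi).2]
  rw [kernelDiff, ← Finset.sum_Ico_eq_sub _ hle, Finset.mul_sum, ← Finset.sum_congr rfl h1,
    lacunary, lacunary, Finset.sum_range_add_sum_Ico _ hle]

/-- Telescoping gives a bound independent of k, hence a bound for the maximal function. -/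
theorem enorm_lacunary_sub_le (hm : ∀ k, 2 ≤ m k) (n k : ℕ) (x : G m) :
    ‖lacunary m k x - lacunary m (min k n) x‖ₑ ≤
      ∑' j, (if n ≤ j then ‖levelCoeff m j‖ₑ else 0) * ‖kernelDiff m j x‖ₑ := by
  refine le_trans ?_ (ENNReal.sum_le_tsum (Finset.range k))
  induction k with
  | zero => simp
  | succ k ih =>
    rw [Finset.sum_range_succ]
    rcases le_or_gt n k with h | h
    · rw [min_eq_right h] at ih
      rw [min_eq_right (h.trans (Nat.le_succ k)), lacunary_succ hm, if_pos h, add_sub_right_comm,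
        ← enorm_mul]
      exact (enorm_add_le _ _).trans (add_le_add ih le_rfl)
    · rw [min_eq_left (Nat.succ_le_of_lt h)]
      simp

theorem hardyNorm_lacunary_sub_le (hm : ∀ k, 2 ≤ m k) (n : ℕ) :
    hardyNorm m (fun k x => lacunary m k x - lacunary m (min k n) x) ≤
      2 * ∑' j, if n ≤ j then ‖levelCoeff m j‖ₑ else 0 := by
  calc hardyNorm m (fun k x => lacunary m k x - lacunary m (min k n) x)
      ≤ ∫⁻ x, ∑' j, (if n ≤ j then ‖levelCoeff m j‖ₑ else 0) * ‖kernelDiff m j x‖ₑ ∂μ m :=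
        lintegral_mono fun x => iSup_le fun k => enorm_lacunary_sub_le hm n k x
    _ = ∑' j, (if n ≤ j then ‖levelCoeff m j‖ₑ else 0) * ∫⁻ x, ‖kernelDiff m j x‖ₑ ∂μ m := by
        rw [lintegral_tsum fun j => ((measurable_kernelDiff m j).enorm.const_mul _).aemeasurable]
        simp only [lintegral_const_mul _ (measurable_kernelDiff m _).enorm]
    _ ≤ ∑' j, (if n ≤ j then ‖levelCoeff m j‖ₑ else 0) * 2 :=
        ENNReal.tsum_le_tsum fun j => by gcongr; exact lintegral_enorm_kernelDiff_le hm j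
    _ = 2 * ∑' j, if n ≤ j then ‖levelCoeff m j‖ₑ else 0 := by
        rw [ENNReal.tsum_mul_right, mul_comm]

theorem tsum_inv_M_le (hm : ∀ k, 2 ≤ m k) (n : ℕ) :
    ∑' k, (if n ≤ k then (M m k : ℝ≥0∞)⁻¹ else 0) ≤ 2 * (M m n : ℝ≥0∞)⁻¹ := by
  have hinj : Function.Injective fun j => n + j := add_right_injective n
  rw [← hinj.tsum_eq (f := fun k => if n ≤ k then (M m k : ℝ≥0∞)⁻¹ else 0)]
  · have hpow : ∀ j, 2 ^ j * M m n ≤ M m (n + j) := by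
      intro j
      induction j with
      | zero => simp
      | succ j ih =>
        calc 2 ^ (j + 1) * M m n = 2 * (2 ^ j * M m n) := by ring
          _ ≤ 2 * M m (n + j) := Nat.mul_le_mul_left _ ih
          _ ≤ M m (n + (j + 1)) := two_mul_M_le hm _
    calc ∑' j, (if n ≤ n + j then (M m (n + j) : ℝ≥0∞)⁻¹ else 0)
        ≤ ∑' j, (2⁻¹ : ℝ≥0∞) ^ j * (M m n : ℝ≥0∞)⁻¹ := by
          refine ENNReal.tsum_le_tsum fun j => ?_
          rw [if_pos (Nat.le_add_right n j), ← ENNReal.inv_pow,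
            ← ENNReal.mul_inv (Or.inl (by simp)) (Or.inl (by simp)), ENNReal.inv_le_inv]
          exact_mod_cast hpow j
      _ = 2 * (M m n : ℝ≥0∞)⁻¹ := by
          rw [ENNReal.tsum_mul_right, ENNReal.tsum_geometric, ENNReal.one_sub_inv_two, inv_inv]
  · intro k hk
    have hk' : n ≤ k := by
      by_contra h
      exact hk (if_neg h)
    exact ⟨k - n, Nat.add_sub_cancel' hk'⟩

/-- The nonzero terms lie along j = 2M_k, and `h` says that the cutoff N on levels is the cutoff n
on k. -/
theorem tsum_levelCoeff_le (hm : ∀ k, 2 ≤ m k) {N n : ℕ}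
    (h : ∀ k, N ≤ 2 * M m k ↔ n ≤ k) :
    ∑' j, (if N ≤ j then ‖levelCoeff m j‖ₑ else 0) ≤ 2 * (M m n : ℝ≥0∞)⁻¹ := by
  have hinj : Function.Injective fun k => 2 * M m k := fun a b hab =>
    (M_strictMono hm).injective (Nat.eq_of_mul_eq_mul_left two_pos hab)
  rw [← hinj.tsum_eq (f := fun j => if N ≤ j then ‖levelCoeff m j‖ₑ else 0)]
  · simp only [h, enorm_levelCoeff_two_mul_M hm]
    exact tsum_inv_M_le hm n
  · intro j hj
    by_contra hj'
    apply hj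
    have : levelCoeff m j = 0 := if_neg fun ⟨k, hk⟩ => hj' ⟨k, hk.symm⟩
    simp [this]

theorem coeffFun_lacunary (hm : ∀ k, 2 ≤ m k) (n i : ℕ) :
    coeffFun m (lacunary m n) i = if i < M m n then levelCoeff m (rank m i) else 0 := by
  unfold lacunary
  rw [coeffFun_sum_psi hm]
  simp only [Finset.mem_range]

theorem integrable_lacunary (hm : ∀ k, 2 ≤ m k) (n : ℕ) : Integrable (lacunary m n) (μ m) :=
  integrable_finsetSum _ fun i _ => (integrable_psi hm i).const_mul _

theorem martingale_lacunary (hm : ∀ k, 2 ≤ m k) :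
    Martingale (lacunary m) (filtration m) (μ m) := by
  refine ⟨fun n => stronglyMeasurable_of_dependsOn fun x y h => ?_, fun i j hij => ?_⟩
  · refine Finset.sum_congr rfl fun k hk => ?_
    rw [dependsOn_psi hm (Finset.mem_range.1 hk) h]
  · have h1 : partialSumFun m (M m i) (lacunary m j) = lacunary m i := by
      funext x
      refine Finset.sum_congr rfl fun k hk => ?_
      rw [coeffFun_lacunary hm,
        if_pos ((Finset.mem_range.1 hk).trans_le ((M_strictMono hm).monotone hij))]
    have h2 := partialSumFun_M_ae_eq_condExp hm (integrable_lacunary hm j) i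
    rw [h1] at h2
    exact h2.symm

theorem memHardy_lacunary (hm : ∀ k, 2 ≤ m k) : MemHardy m (lacunary m) := by
  refine ⟨martingale_lacunary hm, ?_⟩
  have h1 := hardyNorm_lacunary_sub_le hm 0
  simp only [Nat.min_zero, lacunary_zero hm, sub_zero] at h1
  refine h1.trans_lt (ENNReal.mul_lt_top (by simp)
    ((tsum_levelCoeff_le hm (n := 0) fun k => by simp).trans_lt ?_))
  simp [M]

/-- The 4 is a factor 2 from the kernel differences times a factor 2 from the geometric tail. -/
theorem modulus_lacunary_le (hm : ∀ k, 2 ≤ m k) (n : ℕ) :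
    modulus m (2 * M m n) (lacunary m) ≤ 4 * (M m n : ℝ≥0∞)⁻¹ := by
  rw [modulus_eq hm (memHardy_lacunary hm)]
  refine (hardyNorm_lacunary_sub_le hm _).trans ?_
  calc 2 * ∑' j, (if 2 * M m n ≤ j then ‖levelCoeff m j‖ₑ else 0)
      ≤ 2 * (2 * (M m n : ℝ≥0∞)⁻¹) := by
        gcongr
        exact tsum_levelCoeff_le hm fun k => by
          rw [Nat.mul_le_mul_left_iff two_pos, (M_strictMono hm).le_iff_le]
    _ = 4 * (M m n : ℝ≥0∞)⁻¹ := by rw [← mul_assoc]; norm_num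

theorem partialSum_lacunary (hm : ∀ k, 2 ≤ m k) (n : ℕ) (x : G m) :
    partialSum m n (lacunary m) x =
      ∑ i ∈ Finset.range n, levelCoeff m (rank m i) * psi m i x := by
  refine Finset.sum_congr rfl fun i _ => ?_
  congr 1
  refine Tendsto.limUnder_eq (tendsto_const_nhds.congr' ?_)
  filter_upwards [eventually_ge_atTop i] with k hk
  rw [coeffFun_lacunary hm, if_pos (hk.trans_lt (lt_M hm k))]

theorem le_eLpNorm_partialSum_lacunary_sub (hm : ∀ k, 2 ≤ m k) (k : ℕ) :
    (4⁻¹ : ℝ≥0∞) ≤ eLpNorm (fun x =>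
      partialSum m (M m (2 * M m k) + alternatingIndex m (M m k)) (lacunary m) x -
        partialSum m (M m (2 * M m k)) (lacunary m) x) 1 (μ m) := by
  have hq := alternatingIndex_lt hm (M m k)
  have h1 : ∀ x, partialSum m (M m (2 * M m k) + alternatingIndex m (M m k)) (lacunary m) x -
      partialSum m (M m (2 * M m k)) (lacunary m) x = levelCoeff m (2 * M m k) *
        (psi m (M m (2 * M m k)) x *
          ∑ t ∈ Finset.range (alternatingIndex m (M m k)), psi m t x) := by
    intro x
    rw [partialSum_lacunary hm, partialSum_lacunary hm, Finset.sum_range_add, add_sub_cancel_left,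
      Finset.mul_sum, Finset.mul_sum]
    refine Finset.sum_congr rfl fun t ht => ?_
    have ht' := (Finset.mem_range.1 ht).trans hq
    have h2 := two_mul_M_le hm (2 * M m k)
    have h3 := psi_add hm 1 (2 * M m k) ht' x
    rw [one_mul] at h3
    -- All indices M_{2M_k} + t stay below M_{2M_k+1}, so they carry the same coefficient 1/M_k.
    rw [rank_eq hm (Nat.le_add_right _ t) (by omega), h3]
  simp only [h1]
  rw [eLpNorm_one_eq_lintegral_enorm]
  have h2 : ∀ x, ‖levelCoeff m (2 * M m k) * (psi m (M m (2 * M m k)) x *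
      ∑ t ∈ Finset.range (alternatingIndex m (M m k)), psi m t x)‖ₑ =
      (M m k : ℝ≥0∞)⁻¹ * ‖∑ t ∈ Finset.range (alternatingIndex m (M m k)), psi m t x‖ₑ := by
    intro x
    rw [enorm_mul, enorm_mul, enorm_levelCoeff_two_mul_M hm,
      ← ofReal_norm (psi m (M m (2 * M m k)) x), norm_psi hm, ENNReal.ofReal_one, one_mul]
  simp only [h2]
  rw [lintegral_const_mul _ (Finset.measurable_fun_sum _ fun i _ => measurable_psi m i).enorm]
  calc (4⁻¹ : ℝ≥0∞) = (M m k : ℝ≥0∞)⁻¹ * ((M m k : ℝ≥0∞) * 4⁻¹) := by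
        rw [← mul_assoc, ENNReal.inv_mul_cancel (by exact_mod_cast (M_pos hm k).ne')
          (ENNReal.natCast_ne_top _), one_mul]
    _ ≤ _ := by gcongr; exact le_lintegral_enorm_sum_psi hm _

theorem not_tendsto_partialSum_lacunary (hm : ∀ k, 2 ≤ m k) {F : G m → ℂ}
    (hF : MemLp F 1 (μ m)) :
    ¬ Tendsto (fun k => eLpNorm (fun x => partialSum m k (lacunary m) x - F x) 1 (μ m))
      atTop (𝓝 0) := by
  intro h
  have hA : Tendsto (fun k => M m (2 * M m k)) atTop atTop :=
    (M_strictMono hm).tendsto_atTop.comp (tendsto_id.const_mul_atTop' two_pos |>.comp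
      (M_strictMono hm).tendsto_atTop)
  have hB : Tendsto (fun k => M m (2 * M m k) + alternatingIndex m (M m k)) atTop atTop :=
    tendsto_atTop_mono (fun k => Nat.le_add_right _ _) hA
  -- Convergence along both index sequences would send the norm of their difference to 0, against
  -- the lower bound 1/4.
  have hsum := (h.comp hB).add (h.comp hA)
  rw [add_zero] at hsum
  have hmeas : ∀ n, AEStronglyMeasurable (fun x => partialSum m n (lacunary m) x - F x) (μ m) :=
    fun n => (Finset.measurable_fun_sum _ fun i _ =>
      (measurable_psi m i).const_mul _).aestronglyMeasurable.sub hF.1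
  have hle : (4⁻¹ : ℝ≥0∞) ≤ 0 := by
    refine ge_of_tendsto hsum (Eventually.of_forall fun k => ?_)
    refine (le_eLpNorm_partialSum_lacunary_sub hm k).trans ?_
    refine le_trans (le_of_eq ?_) (eLpNorm_sub_le (hmeas _) (hmeas _) le_rfl)
    congr 1
    funext x
    simp
  simp at hle

end Lacunary

end Vilenkin

/-! ### The two halves combined -/

open Vilenkin in
theorem theorem4 (m : ℕ → ℕ) (hm : ∀ k, 2 ≤ m k) :
    ((∃ B, ∀ k, m k ≤ B) →
      ∀ f : ℕ → G m → ℂ, MemHardy m f →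
        (fun n => (modulus m n f).toReal) =o[atTop] (fun n : ℕ => 1 / (n : ℝ)) →
        Represents m (limit m f) f ∧
          Tendsto (fun k => eLpNorm (fun x => partialSum m k f x - limit m f x) 1 (μ m))
            atTop (𝓝 0)) ∧
    (∃ f : ℕ → G m → ℂ, MemHardy m f ∧
      (∀ n, modulus m n f < ∞) ∧
      (fun n => (modulus m (2 * M m n) f).toReal) =O[atTop] (fun n : ℕ => 1 / (M m n : ℝ)) ∧
      Represents m (limit m f) f ∧
      ¬ Tendsto (fun k => eLpNorm (fun x => partialSum m k f x - limit m f x) 1 (μ m))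
          atTop (𝓝 0)) := by
  constructor
  · rintro ⟨B, hB⟩ f hf ho
    have hF := represents_limit hm hf
    exact ⟨hF, tendsto_partialSum_of_modulus_isLittleO hm hB hf ho hF⟩
  · have hf := memHardy_lacunary hm
    have hF := represents_limit hm hf
    refine ⟨lacunary m, hf, modulus_lt_top hm hf, ?_, hF,
      not_tendsto_partialSum_lacunary hm hF.1⟩
    refine IsBigO.of_bound 4 (Eventually.of_forall fun n => ?_)
    have hpos : (M m n : ℝ≥0∞) ≠ 0 := by exact_mod_cast (M_pos hm n).ne'
    have h := ENNReal.toReal_mono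
      (ENNReal.mul_ne_top (by simp) (ENNReal.inv_ne_top.2 hpos)) (modulus_lacunary_le hm n)
    rw [Real.norm_of_nonneg ENNReal.toReal_nonneg, Real.norm_of_nonneg (by positivity), one_div]
    simpa using h
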